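/- Let $\mathcal A$ be a Fréchet algebra, i.e. a complete Hausdorff (real or complex) associative algebra, not necessarily unital, whose topology is given by an increasing sequence $(p_n)_{n\in\mathbb N}$ of submultiplicative seminorms, and let $I$ be a closed two-sided ideal of $\mathcal A$ (in particular a linear subspace). For a topological algebra $\mathcal B$, a Banach $\mathcal B$-bimodule is a Banach space $E$ with a $\mathcal B$-bimodule structure whose actions $\mathcal B\times E\to E$ and $E\times\mathcal B\to E$ are bilinear and separately continuous. Its dual $E^*$, with the norm topology, is given the actions $(a\cdot\varphi)(x)=\varphi(x\cdot a)$ and $(\varphi\cdot a)(x)=\varphi(a\cdot x)$. A continuous derivation $D:\mathcal B\to E^*$ is a continuous linear map with $D(ab)=a\cdot D(b)+D(a)\cdot b$ for all $a,b\in\mathcal B$. The algebra $\mathcal B$ is called amenable if for every Banach $\mathcal B$-bimodule $E$ and every continuous derivation $D:\mathcal B\to E^*$ there is $\varphi\in E^*$ with $D(a)=a\cdot\varphi-\varphi\cdot a$ for all $a\in\mathcal B$. The algebra $\mathcal A$ is called amenable modulo $I$ if for every Banach $\mathcal A$-bimodule $E$ with $I\cdot E=E\cdot I=0$ and every continuous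 derivation $D:\mathcal A\to E^*$ there is $\varphi\in E^*$ with $D(a)=a\cdot\varphi-\varphi\cdot a$ for all $a\in\mathcal A\setminus I$. Equip $I$ with the subspace topology and $\mathcal A/I$ with the quotient topology, and let $I^2$ denote the linear span of $\{ab : a,b\in I\}$ (without closure). Then: (i) If $\mathcal A$ is amenable modulo $I$, then $\mathcal A/I$ is amenable. (ii) If $\mathcal A$ is amenable modulo $I$ and $I$ is amenable, then $\mathcal A$ is amenable. (iii) If $\mathcal A/I$ is amenable and $I^2=I$, then $\mathcal A$ is amenable modulo $I$. -/

import Mathlib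

open Topology

universe u v w

/-- `A` is a Fréchet algebra over `𝕜` (`ℝ` or `ℂ`): a complete Hausdorff algebra, associative and not
necessarily unital or commutative, whose topology is given by an increasing sequence of
submultiplicative seminorms. -/
class IsFrechetAlgebra (𝕜 : Type*) (A : Type*) [RCLike 𝕜] [NonUnitalRing A] [Module 𝕜 A]
    [IsScalarTower 𝕜 A A] [SMulCommClass 𝕜 A A] [UniformSpace A] [IsUniformAddGroup A] : Prop where
  complete : CompleteSpace A
  hausdorff : T2Space A
  exists_seminorms : ∃ p : ℕ → Seminorm 𝕜 A,
    Monotone p ∧ (∀ n a b, p n (a * b) ≤ p n a * p n b) ∧ WithSeminorms p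

/-- A closed two-sided ideal (a linear subspace absorbing multiplication on both sides). -/
structure ClosedIdeal (𝕜 : Type*) (A : Type*) [RCLike 𝕜] [NonUnitalRing A] [Module 𝕜 A]
    [TopologicalSpace A] where
  toSubmodule : Submodule 𝕜 A
  mul_mem_left : ∀ (a : A) {x : A}, x ∈ toSubmodule → a * x ∈ toSubmodule
  mul_mem_right : ∀ (a : A) {x : A}, x ∈ toSubmodule → x * a ∈ toSubmodule
  isClosed : IsClosed (toSubmodule : Set A)

namespace ClosedIdeal

section

variable {𝕜 : Type*} {A : Type*} [RCLike 𝕜] [NonUnitalRing A] [Module 𝕜 A] [TopologicalSpace A]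

/-- The ideal `I` regarded as an algebra, with the operations and the topology induced from `A`. -/
abbrev toSubalgebra (I : ClosedIdeal 𝕜 A) : NonUnitalSubalgebra 𝕜 A :=
  { I.toSubmodule with mul_mem' := fun {a _} _ hb => I.mul_mem_left a hb }

/-- `I² = I`, where `I²` is the linear span of the products `a * b` with `a, b ∈ I`
(no closure is taken). -/
def SqEqSelf (I : ClosedIdeal 𝕜 A) : Prop :=
  Submodule.span 𝕜 {x : A | ∃ a ∈ I.toSubmodule, ∃ b ∈ I.toSubmodule, x = a * b} = I.toSubmodule

/-- The quotient space `A / I` (quotient vector space with the quotient topology). -/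
def Quotient (I : ClosedIdeal 𝕜 A) : Type _ := A ⧸ I.toSubmodule

namespace Quotient

variable (I : ClosedIdeal 𝕜 A)

instance : AddCommGroup I.Quotient := inferInstanceAs (AddCommGroup (A ⧸ I.toSubmodule))

instance : Module 𝕜 I.Quotient := inferInstanceAs (Module 𝕜 (A ⧸ I.toSubmodule))

instance : TopologicalSpace I.Quotient := inferInstanceAs (TopologicalSpace (A ⧸ I.toSubmodule))

/-- The quotient map `A → A / I`. -/
def mk : A →ₗ[𝕜] I.Quotient := I.toSubmodule.mkQ

theorem mk_surjective : Function.Surjective (mk I) := I.toSubmodule.mkQ_surjective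

/-- The multiplication `(a + I) * (b + I) = a * b + I`. -/
instance : Mul I.Quotient where
  mul := _root_.Quotient.map₂ (sa := I.toSubmodule.quotientRel) (sb := I.toSubmodule.quotientRel)
    (sc := I.toSubmodule.quotientRel) (fun a b => a * b) (by
      intro a a' ha b b' hb
      have ha' := (Submodule.quotientRel_def _).1 ha
      have hb' := (Submodule.quotientRel_def _).1 hb
      refine (Submodule.quotientRel_def _).2 ?_
      have h : a * b - a' * b' = a * (b - b') + (a - a') * b' := by
        rw [mul_sub, sub_mul]; abel
      rw [h]
      exact I.toSubmodule.add_mem (I.mul_mem_left _ hb') (I.mul_mem_right _ ha'))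

theorem mk_mul (a b : A) : mk I (a * b) = mk I a * mk I b := rfl

instance : NonUnitalRing I.Quotient where
  __ := (inferInstance : AddCommGroup I.Quotient)
  left_distrib x y z := by
    obtain ⟨a, rfl⟩ := mk_surjective I x
    obtain ⟨b, rfl⟩ := mk_surjective I y
    obtain ⟨c, rfl⟩ := mk_surjective I z
    exact congrArg (mk I) (mul_add a b c)
  right_distrib x y z := by
    obtain ⟨a, rfl⟩ := mk_surjective I x
    obtain ⟨b, rfl⟩ := mk_surjective I y
    obtain ⟨c, rfl⟩ := mk_surjective I z
    exact congrArg (mk I) (add_mul a b c)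
  zero_mul x := by
    obtain ⟨a, rfl⟩ := mk_surjective I x
    exact congrArg (mk I) (zero_mul a)
  mul_zero x := by
    obtain ⟨a, rfl⟩ := mk_surjective I x
    exact congrArg (mk I) (mul_zero a)
  mul_assoc x y z := by
    obtain ⟨a, rfl⟩ := mk_surjective I x
    obtain ⟨b, rfl⟩ := mk_surjective I y
    obtain ⟨c, rfl⟩ := mk_surjective I z
    exact congrArg (mk I) (mul_assoc a b c)

instance [IsScalarTower 𝕜 A A] : IsScalarTower 𝕜 I.Quotient I.Quotient where
  smul_assoc r x y := by
    obtain ⟨a, rfl⟩ := mk_surjective I x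
    obtain ⟨b, rfl⟩ := mk_surjective I y
    exact congrArg (mk I) (smul_assoc r a b)

instance [SMulCommClass 𝕜 A A] : SMulCommClass 𝕜 I.Quotient I.Quotient where
  smul_comm r x y := by
    obtain ⟨a, rfl⟩ := mk_surjective I x
    obtain ⟨b, rfl⟩ := mk_surjective I y
    exact congrArg (mk I) (smul_comm r a b)

end Quotient

end

end ClosedIdeal

/-- The structure of an `A`-bimodule with separately continuous actions on the normed space `E`:
`left a x` is `a · x` and `right a x` is `x · a`. -/
structure ContBimodule (𝕜 : Type*) (A : Type*) (E : Type*) [RCLike 𝕜] [NonUnitalRing A]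
    [Module 𝕜 A] [TopologicalSpace A] [NormedAddCommGroup E] [NormedSpace 𝕜 E] where
  left : A →ₗ[𝕜] E →L[𝕜] E
  right : A →ₗ[𝕜] E →L[𝕜] E
  left_mul : ∀ a b x, left (a * b) x = left a (left b x)
  right_mul : ∀ a b x, right (a * b) x = right b (right a x)
  left_right : ∀ a b x, left a (right b x) = right b (left a x)
  continuous_left : ∀ x, Continuous fun a => left a x
  continuous_right : ∀ x, Continuous fun a => right a x

namespace ContBimodule

section

variable {𝕜 : Type*} {A : Type*} {E : Type*} [RCLike 𝕜] [NonUnitalRing A] [Module 𝕜 A]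
  [TopologicalSpace A] [NormedAddCommGroup E] [NormedSpace 𝕜 E]

/-- The left action of `A` on the dual `E*`: `(a · φ)(x) = φ(x · a)`. -/
def dualLeft (M : ContBimodule 𝕜 A E) (a : A) (φ : StrongDual 𝕜 E) : StrongDual 𝕜 E :=
  φ.comp (M.right a)

/-- The right action of `A` on the dual `E*`: `(φ · a)(x) = φ(a · x)`. -/
def dualRight (M : ContBimodule 𝕜 A E) (a : A) (φ : StrongDual 𝕜 E) : StrongDual 𝕜 E :=
  φ.comp (M.left a)

/-- The continuous linear map `D : A → E*` (norm topology on `E*`) is a derivation: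
`D (a b) = a · D b + D a · b`. -/
def IsDerivation (M : ContBimodule 𝕜 A E) (D : A →L[𝕜] StrongDual 𝕜 E) : Prop :=
  ∀ a b, D (a * b) = M.dualLeft a (D b) + M.dualRight b (D a)

/-- `I · E = E · I = 0`. -/
def KilledBy (M : ContBimodule 𝕜 A E) (I : ClosedIdeal 𝕜 A) : Prop :=
  ∀ a ∈ I.toSubmodule, ∀ x, M.left a x = 0 ∧ M.right a x = 0

/-- `D` coincides on the set `S` with the inner derivation `a ↦ a · φ - φ · a` of some `φ ∈ E*`. -/
def IsInnerOn (M : ContBimodule 𝕜 A E) (D : A →L[𝕜] StrongDual 𝕜 E) (S : Set A) : Prop :=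
  ∃ φ : StrongDual 𝕜 E, ∀ a ∈ S, D a = M.dualLeft a φ - M.dualRight a φ

end

end ContBimodule

/-- `A` is amenable: for every Banach `A`-bimodule `E`, every continuous derivation `A → E*` is
inner. -/
def IsAmenable (𝕜 : Type w) (A : Type u) [RCLike 𝕜] [NonUnitalRing A] [Module 𝕜 A]
    [TopologicalSpace A] : Prop :=
  ∀ (E : Type (max u v)) [NormedAddCommGroup E] [NormedSpace 𝕜 E] [CompleteSpace E]
    (M : ContBimodule 𝕜 A E) (D : A →L[𝕜] StrongDual 𝕜 E),
    M.IsDerivation D → M.IsInnerOn D Set.univ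

/-- `A` is amenable modulo the closed ideal `I`: for every Banach `A`-bimodule `E` with
`I · E = E · I = 0`, every continuous derivation `A → E*` is inner on `A \ I`. -/
def IsAmenableModulo {𝕜 : Type w} {A : Type u} [RCLike 𝕜] [NonUnitalRing A] [Module 𝕜 A]
    [TopologicalSpace A] (I : ClosedIdeal 𝕜 A) : Prop :=
  ∀ (E : Type (max u v)) [NormedAddCommGroup E] [NormedSpace 𝕜 E] [CompleteSpace E]
    (M : ContBimodule 𝕜 A E) (D : A →L[𝕜] StrongDual 𝕜 E),
    M.KilledBy I → M.IsDerivation D → M.IsInnerOn D {a | a ∉ I.toSubmodule}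

/-! On a bimodule killed by `I`, every inner derivation vanishes on `I`. A derivation that also
vanishes on `I` is therefore inner as soon as it is inner off `I`. This gives (i) by pulling back
along `A → A/I`. For (iii), if `I` kills `E` then `D (a * b) = a · D b + D a · b = 0` for `a, b ∈
I`, so `I² = I` makes `D` descend to `A/I`. For (ii), amenability of `I` gives `φ` implementing `D`
on `I`. Subtracting the inner derivation of `φ` leaves a derivation `D₁` vanishing on `I`. Its
values annihilate the closed span `N` of `I · E ∪ E · I` (`essential_le_ker`), so `D₁` takes values
in `(E/N)*`, where `E/N` is killed by `I`. Amenability modulo `I` now provides `ψ`, and `ψ ∘ q + φ`,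
with `q : E → E/N`, implements `D`. The Fréchet hypothesis enters only through barrelledness, which
makes inner derivations norm-continuous although the actions are only separately continuous. -/

namespace ContinuousLinearMap

/-- A linear map from a barrelled space into a space of continuous linear maps is continuous for
the operator norm as soon as it is continuous for pointwise convergence. -/
theorem continuous_of_forall_continuous_apply {𝕜 A E F : Type*} [RCLike 𝕜] [AddCommGroup A]
    [Module 𝕜 A] [TopologicalSpace A] [IsTopologicalAddGroup A] [BarrelledSpace 𝕜 A]
    [NormedAddCommGroup E] [NormedSpace 𝕜 E] [NormedAddCommGroup F] [NormedSpace 𝕜 F]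
    (T : A →ₗ[𝕜] E →L[𝕜] F) (hT : ∀ x, Continuous fun a => T a x) : Continuous T := by
  have hp : Continuous ((normSeminorm 𝕜 (E →L[𝕜] F)).comp T) := by
    -- Uniform boundedness: `a ↦ ‖T a‖` has closed sublevel sets, being cut out by the conditions
    -- `‖T a x‖ ≤ c * ‖x‖`.
    refine Seminorm.continuous_of_lowerSemicontinuous _ ?_
    rw [lowerSemicontinuous_iff_isClosed_preimage]
    intro c
    rcases lt_or_ge c 0 with hc | hc
    · convert isClosed_empty
      ext a
      simpa using hc.trans_le (norm_nonneg (T a))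
    · have h : ((normSeminorm 𝕜 (E →L[𝕜] F)).comp T) ⁻¹' Set.Iic c =
          ⋂ x, {a | ‖T a x‖ ≤ c * ‖x‖} := by
        ext a
        simp [ContinuousLinearMap.opNorm_le_iff hc]
      rw [h]
      exact isClosed_iInter fun x => isClosed_le (hT x).norm continuous_const
  refine continuous_of_continuousAt_zero T ?_
  have h0 := hp.tendsto 0
  rw [map_zero] at h0
  rw [ContinuousAt, map_zero]
  exact squeeze_zero_norm (fun a => le_rfl) h0

end ContinuousLinearMap

/-- Countably many seminorms make the uniformity countably generated; with completeness, Baire's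
theorem applies. -/
theorem IsFrechetAlgebra.barrelledSpace (𝕜 A : Type*) [RCLike 𝕜] [NonUnitalRing A] [Module 𝕜 A]
    [IsScalarTower 𝕜 A A] [SMulCommClass 𝕜 A A] [UniformSpace A] [IsUniformAddGroup A]
    [h : IsFrechetAlgebra 𝕜 A] : BarrelledSpace 𝕜 A := by
  obtain ⟨p, -, -, hp⟩ := h.exists_seminorms
  have := h.complete
  have : FirstCountableTopology A := hp.firstCountableTopology
  have : (uniformity A).IsCountablyGenerated :=
    IsUniformAddGroup.uniformity_countably_generated
  have : ContinuousSMul 𝕜 A := hp.continuousSMul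
  let := UniformSpace.pseudoMetricSpace A
  infer_instance

namespace ContBimodule

section Restriction

variable {𝕜 A B E : Type*} [RCLike 𝕜] [NonUnitalRing A] [Module 𝕜 A] [TopologicalSpace A]
  [NonUnitalRing B] [Module 𝕜 B] [TopologicalSpace B] [NormedAddCommGroup E] [NormedSpace 𝕜 E]

/-- Restriction of scalars along a continuous multiplicative linear map. -/
def restrictScalars (M : ContBimodule 𝕜 A E) (f : B →L[𝕜] A) (hf : ∀ a b, f (a * b) = f a * f b) :
    ContBimodule 𝕜 B E where
  left := M.left ∘ₗ (f : B →ₗ[𝕜] A)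
  right := M.right ∘ₗ (f : B →ₗ[𝕜] A)
  left_mul a b x := by simp [hf, M.left_mul]
  right_mul a b x := by simp [hf, M.right_mul]
  left_right a b x := M.left_right _ _ x
  continuous_left x := (M.continuous_left x).comp f.continuous
  continuous_right x := (M.continuous_right x).comp f.continuous

theorem IsDerivation.restrictScalars {M : ContBimodule 𝕜 A E} {D : A →L[𝕜] StrongDual 𝕜 E}
    (hD : M.IsDerivation D) (f : B →L[𝕜] A) (hf : ∀ a b, f (a * b) = f a * f b) :
    (M.restrictScalars f hf).IsDerivation (D.comp f) := fun a b => by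
  change D (f (a * b)) = _
  rw [hf, hD]
  rfl

end Restriction

section Dual

variable {𝕜 A E : Type*} [RCLike 𝕜] [NonUnitalRing A] [Module 𝕜 A] [TopologicalSpace A]
  [NormedAddCommGroup E] [NormedSpace 𝕜 E]

theorem KilledBy.dualLeft {M : ContBimodule 𝕜 A E} {I : ClosedIdeal 𝕜 A} (h : M.KilledBy I) {a : A}
    (ha : a ∈ I.toSubmodule) (φ : StrongDual 𝕜 E) : M.dualLeft a φ = 0 := by
  ext x
  simp [ContBimodule.dualLeft, (h a ha x).2]

theorem KilledBy.dualRight {M : ContBimodule 𝕜 A E} {I : ClosedIdeal 𝕜 A} (h : M.KilledBy I) {a : A}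
    (ha : a ∈ I.toSubmodule) (φ : StrongDual 𝕜 E) : M.dualRight a φ = 0 := by
  ext x
  simp [ContBimodule.dualRight, (h a ha x).1]

/-- On a bimodule killed by `I`, a derivation vanishing on `I` that is inner off `I` is inner. -/
theorem KilledBy.isInnerOn_univ {M : ContBimodule 𝕜 A E} {I : ClosedIdeal 𝕜 A} (h : M.KilledBy I)
    {D : A →L[𝕜] StrongDual 𝕜 E} (hD : ∀ a ∈ I.toSubmodule, D a = 0)
    (hi : M.IsInnerOn D {a | a ∉ I.toSubmodule}) : M.IsInnerOn D Set.univ := by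
  obtain ⟨φ, hφ⟩ := hi
  refine ⟨φ, fun a _ => ?_⟩
  by_cases ha : a ∈ I.toSubmodule
  · rw [hD a ha, h.dualLeft ha, h.dualRight ha, sub_zero]
  · exact hφ a ha

/-- On a bimodule killed by `I = I²`, every derivation vanishes on `I`. -/
theorem IsDerivation.eq_zero_of_sqEqSelf {M : ContBimodule 𝕜 A E} {D : A →L[𝕜] StrongDual 𝕜 E}
    (hD : M.IsDerivation D) {I : ClosedIdeal 𝕜 A} (h : M.KilledBy I) (hI : I.SqEqSelf) {a : A}
    (ha : a ∈ I.toSubmodule) : D a = 0 := by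
  rw [← hI] at ha
  have hle : Submodule.span 𝕜 {x : A | ∃ a ∈ I.toSubmodule, ∃ b ∈ I.toSubmodule, x = a * b} ≤
      LinearMap.ker (D : A →ₗ[𝕜] StrongDual 𝕜 E) := by
    rw [Submodule.span_le]
    rintro _ ⟨a, ha, b, hb, rfl⟩
    change D (a * b) = 0
    rw [hD, h.dualLeft ha, h.dualRight hb, add_zero]
  exact hle ha

/-- The inner derivation `a ↦ a · φ - φ · a` of a bimodule whose actions are norm-continuous. -/
def inner (M : ContBimodule 𝕜 A E) (hl : Continuous M.left) (hr : Continuous M.right)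
    (φ : StrongDual 𝕜 E) : A →L[𝕜] StrongDual 𝕜 E where
  toFun a := M.dualLeft a φ - M.dualRight a φ
  map_add' a b := by
    ext x
    simp [dualLeft, dualRight]
    ring
  map_smul' c a := by
    ext x
    simp [dualLeft, dualRight]
    ring
  cont := by
    unfold dualLeft dualRight
    fun_prop

theorem inner_isDerivation (M : ContBimodule 𝕜 A E) (hl : Continuous M.left)
    (hr : Continuous M.right) (φ : StrongDual 𝕜 E) : M.IsDerivation (M.inner hl hr φ) := by
  intro a b
  ext x
  simp [inner, dualLeft, dualRight, M.left_mul, M.right_mul, M.left_right]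

theorem IsDerivation.sub {M : ContBimodule 𝕜 A E} {D D' : A →L[𝕜] StrongDual 𝕜 E}
    (hD : M.IsDerivation D) (hD' : M.IsDerivation D') : M.IsDerivation (D - D') := by
  intro a b
  ext x
  simp [hD a b, hD' a b, dualLeft, dualRight]
  ring

end Dual

/-! ### Quotients of the algebra and of the module -/

section Descend

variable {𝕜 A E : Type*} [RCLike 𝕜] [NonUnitalRing A] [Module 𝕜 A] [TopologicalSpace A]
  [NormedAddCommGroup E] [NormedSpace 𝕜 E]

/-- A bimodule killed by `I` is a bimodule over the quotient by `I`. -/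
def descend (M : ContBimodule 𝕜 A E) {I : ClosedIdeal 𝕜 A} (h : M.KilledBy I) :
    ContBimodule 𝕜 I.Quotient E where
  left := I.toSubmodule.liftQ M.left fun a ha => ContinuousLinearMap.ext fun x => (h a ha x).1
  right := I.toSubmodule.liftQ M.right fun a ha => ContinuousLinearMap.ext fun x => (h a ha x).2
  left_mul a b x := by
    obtain ⟨a, rfl⟩ := ClosedIdeal.Quotient.mk_surjective I a
    obtain ⟨b, rfl⟩ := ClosedIdeal.Quotient.mk_surjective I b
    exact M.left_mul a b x
  right_mul a b x := by
    obtain ⟨a, rfl⟩ := ClosedIdeal.Quotient.mk_surjective I a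
    obtain ⟨b, rfl⟩ := ClosedIdeal.Quotient.mk_surjective I b
    exact M.right_mul a b x
  left_right a b x := by
    obtain ⟨a, rfl⟩ := ClosedIdeal.Quotient.mk_surjective I a
    obtain ⟨b, rfl⟩ := ClosedIdeal.Quotient.mk_surjective I b
    exact M.left_right a b x
  continuous_left x := I.toSubmodule.isQuotientMap_mkQL.continuous_iff.2 (M.continuous_left x)
  continuous_right x := I.toSubmodule.isQuotientMap_mkQL.continuous_iff.2 (M.continuous_right x)

end Descend

section QuotientModule

variable {𝕜 A E : Type*} [RCLike 𝕜] [NonUnitalRing A] [Module 𝕜 A] [TopologicalSpace A]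
  [NormedAddCommGroup E] [NormedSpace 𝕜 E] (M : ContBimodule 𝕜 A E)

/-- The operators induced on the quotient by an invariant subspace. -/
def quotientAction (T : A →ₗ[𝕜] E →L[𝕜] E) (N : Submodule 𝕜 E) (hN : ∀ a, ∀ x ∈ N, T a x ∈ N) :
    A →ₗ[𝕜] (E ⧸ N) →L[𝕜] (E ⧸ N) where
  toFun a := N.liftQL (N.mkQL.comp (T a)) fun x hx => by simpa using hN a x hx
  map_add' a b := by
    ext x
    obtain ⟨x, rfl⟩ := N.mkQ_surjective x
    simp
  map_smul' c a := by
    ext x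
    obtain ⟨x, rfl⟩ := N.mkQ_surjective x
    simp

variable (N : Submodule 𝕜 E) [IsClosed (N : Set E)] (hl : ∀ a, ∀ x ∈ N, M.left a x ∈ N)
  (hr : ∀ a, ∀ x ∈ N, M.right a x ∈ N)

/-- The quotient of a bimodule by a closed sub-bimodule. -/
def quotient : ContBimodule 𝕜 A (E ⧸ N) where
  left := quotientAction M.left N hl
  right := quotientAction M.right N hr
  left_mul a b x := by
    obtain ⟨x, rfl⟩ := N.mkQ_surjective x
    exact congrArg N.mkQ (M.left_mul a b x)
  right_mul a b x := by
    obtain ⟨x, rfl⟩ := N.mkQ_surjective x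
    exact congrArg N.mkQ (M.right_mul a b x)
  left_right a b x := by
    obtain ⟨x, rfl⟩ := N.mkQ_surjective x
    exact congrArg N.mkQ (M.left_right a b x)
  continuous_left x := by
    obtain ⟨x, rfl⟩ := N.mkQ_surjective x
    exact N.mkQL.continuous.comp (M.continuous_left x)
  continuous_right x := by
    obtain ⟨x, rfl⟩ := N.mkQ_surjective x
    exact N.mkQL.continuous.comp (M.continuous_right x)

end QuotientModule

/-! ### The closed sub-bimodule generated by the action of `I` -/

section Essential

variable {𝕜 A E : Type*} [RCLike 𝕜] [NonUnitalRing A] [Module 𝕜 A] [TopologicalSpace A]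
  [NormedAddCommGroup E] [NormedSpace 𝕜 E] (M : ContBimodule 𝕜 A E)

/-- The closed linear span of `I · E ∪ E · I`. -/
def essential (I : ClosedIdeal 𝕜 A) : Submodule 𝕜 E :=
  (Submodule.span 𝕜 {y | ∃ a ∈ I.toSubmodule, ∃ x, y = M.left a x ∨ y = M.right a x}
    ).topologicalClosure

variable (I : ClosedIdeal 𝕜 A)

theorem isClosed_essential : IsClosed (M.essential I : Set E) :=
  Submodule.isClosed_topologicalClosure _

variable {I}

theorem left_mem_essential {a : A} (ha : a ∈ I.toSubmodule) (x : E) :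
    M.left a x ∈ M.essential I :=
  Submodule.le_topologicalClosure _ (Submodule.subset_span ⟨a, ha, x, .inl rfl⟩)

theorem right_mem_essential {a : A} (ha : a ∈ I.toSubmodule) (x : E) :
    M.right a x ∈ M.essential I :=
  Submodule.le_topologicalClosure _ (Submodule.subset_span ⟨a, ha, x, .inr rfl⟩)

theorem essential_le {N : Submodule 𝕜 E} (hN : IsClosed (N : Set E))
    (hl : ∀ a ∈ I.toSubmodule, ∀ x, M.left a x ∈ N)
    (hr : ∀ a ∈ I.toSubmodule, ∀ x, M.right a x ∈ N) : M.essential I ≤ N := by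
  refine Submodule.topologicalClosure_minimal _ (Submodule.span_le.2 ?_) hN
  rintro _ ⟨a, ha, x, rfl | rfl⟩
  exacts [hl a ha x, hr a ha x]

/-- On generators, `a · (b · x) = (a * b) · x` and `a · (x · b) = (a · x) · b`; continuity extends
this to the closure. -/
theorem left_essential (a : A) {x : E} (hx : x ∈ M.essential I) : M.left a x ∈ M.essential I := by
  have h : M.essential I ≤ (M.essential I).comap (M.left a : E →ₗ[𝕜] E) := by
    refine M.essential_le ((M.isClosed_essential I).preimage (M.left a).continuous) ?_ ?_
    · intro b hb x
      change M.left a (M.left b x) ∈ M.essential I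
      rw [← M.left_mul]
      exact M.left_mem_essential (I.mul_mem_left a hb) x
    · intro b hb x
      change M.left a (M.right b x) ∈ M.essential I
      rw [M.left_right]
      exact M.right_mem_essential hb _
  exact h hx

theorem right_essential (a : A) {x : E} (hx : x ∈ M.essential I) :
    M.right a x ∈ M.essential I := by
  have h : M.essential I ≤ (M.essential I).comap (M.right a : E →ₗ[𝕜] E) := by
    refine M.essential_le ((M.isClosed_essential I).preimage (M.right a).continuous) ?_ ?_
    · intro b hb x
      change M.right a (M.left b x) ∈ M.essential I
      rw [← M.left_right]
      exact M.left_mem_essential hb _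
    · intro b hb x
      change M.right a (M.right b x) ∈ M.essential I
      rw [← M.right_mul]
      exact M.right_mem_essential (I.mul_mem_right a hb) x
  exact h hx

/-- The values of a derivation vanishing on `I` annihilate `I · E` and `E · I`. -/
theorem IsDerivation.essential_le_ker {M : ContBimodule 𝕜 A E} {D : A →L[𝕜] StrongDual 𝕜 E}
    (hD : M.IsDerivation D) (h0 : ∀ a ∈ I.toSubmodule, D a = 0) (a : A) :
    M.essential I ≤ LinearMap.ker (D a : E →ₗ[𝕜] 𝕜) := by
  refine M.essential_le (D a).isClosed_ker ?_ ?_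
  · intro b hb x
    -- Since `D b` and `D (a * b)` vanish, the derivation identity reduces to `D a · b = 0`.
    have h := hD a b
    rw [h0 b hb, h0 _ (I.mul_mem_left a hb)] at h
    simpa [dualLeft, dualRight] using (DFunLike.congr_fun h x).symm
  · intro b hb x
    have h := hD b a
    rw [h0 b hb, h0 _ (I.mul_mem_right a hb)] at h
    simpa [dualLeft, dualRight] using (DFunLike.congr_fun h x).symm

end Essential

end ContBimodule

/-- A continuous linear map into the dual of `E` whose values annihilate `N` factors through the
dual of `E ⧸ N`. -/
def ContinuousLinearMap.liftDual {𝕜 A E : Type*} [RCLike 𝕜] [AddCommGroup A] [Module 𝕜 A]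
    [TopologicalSpace A] [IsTopologicalAddGroup A] [NormedAddCommGroup E] [NormedSpace 𝕜 E]
    (D : A →L[𝕜] StrongDual 𝕜 E) (N : Submodule 𝕜 E) [IsClosed (N : Set E)]
    (h : ∀ a, N ≤ LinearMap.ker (D a : E →ₗ[𝕜] 𝕜)) : A →L[𝕜] StrongDual 𝕜 (E ⧸ N) :=
  let L : A →ₗ[𝕜] StrongDual 𝕜 (E ⧸ N) :=
    { toFun := fun a => N.liftQL (D a) (h a)
      map_add' := fun a b => by
        ext x
        obtain ⟨x, rfl⟩ := N.mkQ_surjective x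
        simp
      map_smul' := fun c a => by
        ext x
        obtain ⟨x, rfl⟩ := N.mkQ_surjective x
        simp }
  { toLinearMap := L
    cont := by
      have hle (a : A) : ‖L a‖ ≤ ‖D a‖ := by
        refine ContinuousLinearMap.opNorm_le_bound _ (norm_nonneg _) fun x => ?_
        -- The quotient norm is only an infimum, so take a representative of norm below `‖x‖ + ε`
        -- and let `ε` tend to `0`.
        refine ge_of_tendsto (f := fun ε : ℝ => ‖D a‖ * (‖x‖ + ε)) (x := 𝓝[>] 0) ?_ ?_
        · refine tendsto_nhdsWithin_of_tendsto_nhds ?_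
          exact Continuous.tendsto' (by fun_prop) _ _ (by simp)
        · filter_upwards [self_mem_nhdsWithin] with ε hε
          obtain ⟨m, rfl, hm⟩ := Submodule.Quotient.norm_mk_lt x hε
          exact (D a).le_opNorm_of_le hm.le
      refine continuous_of_continuousAt_zero L ?_
      have h0 := D.continuous.norm.tendsto 0
      rw [map_zero, norm_zero] at h0
      rw [ContinuousAt, map_zero]
      exact squeeze_zero_norm hle h0 }

/-! ### The three implications -/

theorem IsAmenableModulo.isAmenable_quotient {𝕜 : Type w} {A : Type u} [RCLike 𝕜] [NonUnitalRing A]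
    [Module 𝕜 A] [TopologicalSpace A] {I : ClosedIdeal 𝕜 A} (h : IsAmenableModulo.{u, v, w} I) :
    IsAmenable.{u, v, w} 𝕜 I.Quotient := by
  intro E _ _ _ M D hD
  let π : A →L[𝕜] I.Quotient := ⟨ClosedIdeal.Quotient.mk I, I.toSubmodule.mkQL.continuous⟩
  have hπ (a : A) (ha : a ∈ I.toSubmodule) : π a = 0 := (Submodule.Quotient.mk_eq_zero _).2 ha
  have hk : (M.restrictScalars π fun _ _ => rfl).KilledBy I := by
    intro a ha x
    change M.left (π a) x = 0 ∧ M.right (π a) x = 0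
    simp [hπ a ha]
  obtain ⟨φ, hφ⟩ := hk.isInnerOn_univ (D := D.comp π)
    (fun a ha => by simp [hπ a ha])
    (h E _ _ hk (hD.restrictScalars π fun _ _ => rfl))
  refine ⟨φ, fun a _ => ?_⟩
  obtain ⟨a, rfl⟩ := ClosedIdeal.Quotient.mk_surjective I a
  exact hφ a trivial

theorem IsAmenable.isAmenableModulo {𝕜 : Type w} {A : Type u} [RCLike 𝕜] [NonUnitalRing A]
    [Module 𝕜 A] [TopologicalSpace A] {I : ClosedIdeal 𝕜 A}
    (h : IsAmenable.{u, v, w} 𝕜 I.Quotient) (hI : I.SqEqSelf) : IsAmenableModulo.{u, v, w} I := by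
  intro E _ _ _ M D hk hD
  have h0 : I.toSubmodule ≤ LinearMap.ker (D : A →ₗ[𝕜] StrongDual 𝕜 E) :=
    fun a ha => hD.eq_zero_of_sqEqSelf hk hI ha
  let D' : I.Quotient →L[𝕜] StrongDual 𝕜 E := I.toSubmodule.liftQL D h0
  have hD' : (M.descend hk).IsDerivation D' := by
    intro a b
    obtain ⟨a, rfl⟩ := ClosedIdeal.Quotient.mk_surjective I a
    obtain ⟨b, rfl⟩ := ClosedIdeal.Quotient.mk_surjective I b
    exact hD a b
  obtain ⟨φ, hφ⟩ := h E _ D' hD'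
  exact ⟨φ, fun a _ => hφ (ClosedIdeal.Quotient.mk I a) trivial⟩

theorem IsAmenableModulo.isAmenable {𝕜 : Type w} {A : Type u} [RCLike 𝕜] [NonUnitalRing A]
    [Module 𝕜 A] [TopologicalSpace A] [IsTopologicalAddGroup A] [BarrelledSpace 𝕜 A]
    {I : ClosedIdeal 𝕜 A} (h : IsAmenableModulo.{u, v, w} I)
    (hI : IsAmenable.{u, v, w} 𝕜 I.toSubalgebra) : IsAmenable.{u, v, w} 𝕜 A := by
  intro E _ _ _ M D hD
  let ι : I.toSubalgebra →L[𝕜] A := I.toSubmodule.subtypeL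
  obtain ⟨φ, hφ⟩ := hI E _ _ (hD.restrictScalars ι fun _ _ => rfl)
  let D₀ := M.inner
    (ContinuousLinearMap.continuous_of_forall_continuous_apply _ M.continuous_left)
    (ContinuousLinearMap.continuous_of_forall_continuous_apply _ M.continuous_right) φ
  have hD₁ : M.IsDerivation (D - D₀) := hD.sub (M.inner_isDerivation _ _ φ)
  have h0 : ∀ a ∈ I.toSubmodule, (D - D₀) a = 0 := fun a ha =>
    sub_eq_zero.2 (hφ ⟨a, ha⟩ trivial)
  have := M.isClosed_essential I
  let M' := M.quotient (M.essential I) (fun a _ => M.left_essential a)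
    fun a _ => M.right_essential a
  have hk : M'.KilledBy I := by
    intro a ha x
    obtain ⟨x, rfl⟩ := (M.essential I).mkQ_surjective x
    exact ⟨(Submodule.Quotient.mk_eq_zero _).2 (M.left_mem_essential ha x),
      (Submodule.Quotient.mk_eq_zero _).2 (M.right_mem_essential ha x)⟩
  let D' := (D - D₀).liftDual (M.essential I) (hD₁.essential_le_ker h0)
  have hD' : M'.IsDerivation D' := by
    intro a b
    ext x
    obtain ⟨x, rfl⟩ := (M.essential I).mkQ_surjective x
    exact DFunLike.congr_fun (hD₁ a b) x
  have hD'0 : ∀ a ∈ I.toSubmodule, D' a = 0 := by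
    intro a ha
    ext x
    obtain ⟨x, rfl⟩ := (M.essential I).mkQ_surjective x
    exact DFunLike.congr_fun (h0 a ha) x
  obtain ⟨ψ, hψ⟩ := hk.isInnerOn_univ hD'0 (h _ _ _ hk hD')
  refine ⟨ψ.comp (M.essential I).mkQL + φ, fun a _ => ?_⟩
  ext x
  have h1 : D a x - (φ (M.right a x) - φ (M.left a x)) =
      ψ ((M.essential I).mkQ (M.right a x)) - ψ ((M.essential I).mkQ (M.left a x)) :=
    DFunLike.congr_fun (hψ a trivial) ((M.essential I).mkQ x)
  rw [sub_eq_iff_eq_add] at h1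
  simp only [h1, ContBimodule.dualLeft, ContBimodule.dualRight, sub_apply,
    add_apply, ContinuousLinearMap.comp_apply, Submodule.mkQL_apply]
  ring

theorem theorem2p3 {𝕜 : Type w} {A : Type u} [RCLike 𝕜] [NonUnitalRing A] [Module 𝕜 A]
    [IsScalarTower 𝕜 A A] [SMulCommClass 𝕜 A A] [UniformSpace A] [IsUniformAddGroup A]
    [IsFrechetAlgebra 𝕜 A] (I : ClosedIdeal 𝕜 A) :
    (IsAmenableModulo.{u, v, w} I → IsAmenable.{u, v, w} 𝕜 I.Quotient) ∧
    (IsAmenableModulo.{u, v, w} I → IsAmenable.{u, v, w} 𝕜 I.toSubalgebra → IsAmenable.{u, v, w} 𝕜 A) ∧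
    (IsAmenable.{u, v, w} 𝕜 I.Quotient → I.SqEqSelf → IsAmenableModulo.{u, v, w} I) := by
  have := IsFrechetAlgebra.barrelledSpace 𝕜 A
  exact ⟨fun h => h.isAmenable_quotient, fun h hI => h.isAmenable hI,
    fun h hI => h.isAmenableModulo hI⟩
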